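/- An oriented knot in $\mathbb{R}^3$ is a subset $k\subset\mathbb{R}^3$ homeomorphic to the circle $S^1$, together with an orientation of $k$ (smooth and polygonal oriented knots are included). A tubular neighbourhood of $k$ is a set $V\subset\mathbb{R}^3$ that is the image of a topological embedding $t:k\times D^2\to\mathbb{R}^3$ with $t(x,0)=x$ for all $x\in k$, where $D^2$ is the closed unit disk. A $3$-ball in $\mathbb{R}^3$ is a subset homeomorphic to the closed unit ball of $\mathbb{R}^3$. Let $k_1$ and $k_2$ be oriented knots in $\mathbb{R}^3$, and let $V_1$ and $V_2$ be tubular neighbourhoods of $k_1$ and $k_2$ respectively. Let $B\subset\mathbb{R}^3$ be a $3$-ball such that $V_1\cup V_2\subset\operatorname{int}B$. Then there exists a continuous map $f:\mathbb{R}^3\to\mathbb{R}^3$ with the following properties. (1) $f$ maps the pair $(V_1,k_1)$ homeomorphically onto the pair $(V_2,k_2)$; that is, $f$ restricts to a homeomorphism from $V_1$ onto $V_2$ and maps $k_1$ onto $k_2$, carrying the orientation of $k_1$ to that of $k_2$. (2) $f(x)=x$ for every $x\in\mathbb{R}^3\setminus\operatorname{int}B$, and $f(B)=B$. -/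

import Mathlib

open Set Topology

/-- Euclidean 3-space. -/
abbrev E3 : Type := EuclideanSpace ℝ (Fin 3)

/-- The closed unit disk in the Euclidean plane. -/
abbrev UnitDisk2 : Set (EuclideanSpace ℝ (Fin 2)) := Metric.closedBall 0 1

/-- The centre of the closed unit disk. -/
def UnitDisk2.centre : UnitDisk2 := ⟨0, Metric.mem_closedBall_self zero_le_one⟩

/-- A self-homeomorphism of the circle preserves orientation if it lifts, through the covering
`t ↦ exp (i t)`, to a continuous strictly increasing map of the real line. -/
def CircleOrientationPreserving (φ : Circle ≃ₜ Circle) : Prop :=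
  ∃ F : ℝ → ℝ, Continuous F ∧ StrictMono F ∧ ∀ t : ℝ, φ (Circle.exp t) = Circle.exp (F t)

/-- An oriented knot in Euclidean 3-space: a subset homeomorphic to the circle, together with an
orientation, given as an equivalence class of parametrisations by the circle (two parametrisations
being equivalent if they differ by an orientation preserving self-homeomorphism of the circle). -/
structure OrientedKnot where
  /-- the underlying set -/
  carrier : Set E3
  /-- the parametrisations that agree with the orientation -/
  positive : Set (Circle ≃ₜ carrier)
  /-- they form exactly one equivalence class -/
  isClass : ∃ γ : Circle ≃ₜ carrier,
    positive = {γ' | CircleOrientationPreserving (γ'.trans γ.symm)}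

/-- `V` is a (closed) tubular neighbourhood of the set `k`: the image of an embedding of
`k × D²` that sends `(x, 0)` to `x` for every `x` in `k`. -/
def IsTubularNeighbourhood (k V : Set E3) : Prop :=
  ∃ t : k × UnitDisk2 → E3,
    IsEmbedding t ∧ (∀ x : k, t (x, UnitDisk2.centre) = x) ∧ range t = V

/-- `B` is a 3-ball: a subspace homeomorphic to the closed unit ball. -/
def IsThreeBall (B : Set E3) : Prop :=
  Nonempty (B ≃ₜ (Metric.closedBall (0 : E3) 1 : Set E3))

/-- `f` maps the pair `(V₁, k₁)` homeomorphically onto the pair `(V₂, k₂)`, where `k₁`, `k₂` are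
oriented knots: `f` restricts to a homeomorphism `V₁ → V₂`, it maps `k₁` onto `k₂`, and it carries
the orientation of `k₁` to that of `k₂`. -/
def MapsPairHomeomorphically (f : E3 → E3) (V₁ : Set E3) (k₁ : OrientedKnot)
    (V₂ : Set E3) (k₂ : OrientedKnot) : Prop :=
  (∃ e : V₁ ≃ₜ V₂, ∀ x : V₁, (e x : E3) = f x) ∧
  f '' k₁.carrier = k₂.carrier ∧
  ∀ γ ∈ k₁.positive, ∃ δ ∈ k₂.positive, ∀ z : Circle, f (γ z : E3) = (δ z : E3)

/-!
The map `f` is only required to be continuous, so outside `V₁` it may be produced by extension.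
A homeomorphism `k₁ ≃ₜ k₂` that respects the orientations, multiplied by the identity of the disk,
gives a homeomorphism `e : V₁ ≃ₜ V₂` through the two tubular embeddings
(`exists_homeomorph_tubularNeighbourhood`). On the closed set `V₁ ∪ frontier B` the map is then
prescribed, namely as `e` on `V₁` and the identity on `frontier B`. Since a 3-ball is an absolute
extensor for normal spaces, these data extend to a continuous map with values in `B`, and gluing
with the identity outside `B` gives a continuous map of `E3`
(`IsThreeBall.exists_continuous_extension`).

To get `f '' B = B` without the no-retraction theorem, one more piece is prescribed. The open set
`interior B` is not contained in `V₁`, because otherwise `V₁ = interior B` would be a nonempty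
compact open subset of the connected noncompact space `E3`. Hence there is a round ball in
`interior B \ V₁`, and the map is required to send this ball onto `B`.
-/

universe u v

/-- Two continuous maps given on disjoint closed subsets of a normal space have a common continuous
extension, if the target has the Tietze extension property. -/
theorem exists_continuousMap_extending_pair {X : Type u} {Y : Type v} [TopologicalSpace X]
    [NormalSpace X] [TopologicalSpace Y] [TietzeExtension.{u, v} Y] {s t : Set X}
    (hs : IsClosed s) (ht : IsClosed t) (hst : Disjoint s t) (f : C(s, Y)) (g : C(t, Y)) :
    ∃ F : C(X, Y), (∀ x : s, F x = f x) ∧ ∀ x : t, F x = g x := by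
  classical
  obtain ⟨f', hf'⟩ := f.exists_restrict_eq hs
  obtain ⟨g', hg'⟩ := g.exists_restrict_eq ht
  have hps : EqOn (s.piecewise f' g') f' s := fun x hx => piecewise_eq_of_mem _ _ _ hx
  have hpt : EqOn (s.piecewise f' g') g' t := fun x hx =>
    piecewise_eq_of_notMem _ _ _ (hst.notMem_of_mem_right hx)
  have hcont : ContinuousOn (s.piecewise f' g') (s ∪ t) :=
    (f'.continuous.continuousOn.congr hps).union_of_isClosed
      (g'.continuous.continuousOn.congr hpt) hs ht
  obtain ⟨F, hF⟩ := ContinuousMap.exists_restrict_eq (hs.union ht)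
    (⟨_, continuousOn_iff_continuous_domRestrict.1 hcont⟩ : C(↥(s ∪ t), Y))
  have hF' : ∀ x ∈ s ∪ t, F x = s.piecewise f' g' x := fun x hx => DFunLike.congr_fun hF ⟨x, hx⟩
  exact ⟨F, fun x => (hF' x (.inl x.2)).trans ((hps x.2).trans (DFunLike.congr_fun hf' x)),
    fun x => (hF' x (.inr x.2)).trans ((hpt x.2).trans (DFunLike.congr_fun hg' x))⟩

theorem exists_surjective_continuousMap_closedBall {E : Type*} [NormedAddCommGroup E]
    [NormedSpace ℝ E] (c : E) {r : ℝ} (hr : 0 < r) :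
    ∃ p : C(Metric.closedBall c r, Metric.closedBall (0 : E) 1), Function.Surjective p := by
  have hmem : ∀ x : Metric.closedBall c r, r⁻¹ • ((x : E) - c) ∈ Metric.closedBall (0 : E) 1 := by
    intro x
    have hx := x.2
    rw [mem_closedBall_iff_norm] at hx
    rw [mem_closedBall_zero_iff, norm_smul, norm_inv, Real.norm_of_nonneg hr.le]
    exact (inv_mul_le_one₀ hr).2 hx
  refine ⟨⟨fun x => ⟨_, hmem x⟩, Continuous.subtype_mk (by fun_prop) hmem⟩, fun y => ?_⟩
  refine ⟨⟨c + r • (y : E), ?_⟩, ?_⟩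
  · rw [mem_closedBall_iff_norm, add_sub_cancel_left, norm_smul, Real.norm_of_nonneg hr.le]
    exact mul_le_of_le_one_right hr.le (mem_closedBall_zero_iff.1 y.2)
  · ext1
    simp [smul_smul, hr.ne']

theorem IsThreeBall.isCompact {B : Set E3} (hB : IsThreeBall B) : IsCompact B := by
  obtain ⟨b⟩ := hB
  have : CompactSpace (Metric.closedBall (0 : E3) 1) :=
    isCompact_iff_compactSpace.1 (isCompact_closedBall _ _)
  have := b.symm.compactSpace
  exact isCompact_iff_compactSpace.2 this

theorem OrientedKnot.compactSpace (k : OrientedKnot) : CompactSpace k.carrier :=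
  k.isClass.choose.compactSpace

theorem OrientedKnot.nonempty (k : OrientedKnot) : k.carrier.Nonempty :=
  ⟨_, (k.isClass.choose 1).2⟩

theorem IsTubularNeighbourhood.subset {k V : Set E3} (h : IsTubularNeighbourhood k V) :
    k ⊆ V := by
  obtain ⟨t, -, ht, rfl⟩ := h
  exact fun x hx => ⟨_, ht ⟨x, hx⟩⟩

theorem IsTubularNeighbourhood.isCompact {k V : Set E3} [CompactSpace k]
    (h : IsTubularNeighbourhood k V) : IsCompact V := by
  obtain ⟨t, ht, -, rfl⟩ := h
  have : CompactSpace UnitDisk2 := isCompact_iff_compactSpace.1 (isCompact_closedBall _ _)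
  exact isCompact_range ht.continuous

/-- A homeomorphism between two subsets of `E3` extends to a homeomorphism between any tubular
neighbourhoods of them. -/
theorem exists_homeomorph_tubularNeighbourhood {k₁ k₂ V₁ V₂ : Set E3} (φ : k₁ ≃ₜ k₂)
    (h₁ : IsTubularNeighbourhood k₁ V₁) (h₂ : IsTubularNeighbourhood k₂ V₂) :
    ∃ e : V₁ ≃ₜ V₂, ∀ x : k₁, (e ⟨x, h₁.subset x.2⟩ : E3) = φ x := by
  obtain ⟨t₁, ht₁, hc₁, rfl⟩ := id h₁
  obtain ⟨t₂, ht₂, hc₂, rfl⟩ := h₂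
  refine ⟨ht₁.toHomeomorph.symm.trans
    ((φ.prodCongr (Homeomorph.refl _)).trans ht₂.toHomeomorph), fun x => ?_⟩
  have hx : ht₁.toHomeomorph.symm ⟨x, h₁.subset x.2⟩ = (x, UnitDisk2.centre) := by
    rw [Homeomorph.symm_apply_eq]
    exact Subtype.ext (hc₁ x).symm
  simp only [Homeomorph.trans_apply, hx]
  exact hc₂ (φ x)

/-- Two oriented knots are homeomorphic by a map that carries one orientation to the other. -/
theorem OrientedKnot.exists_homeomorph (k₁ k₂ : OrientedKnot) :
    ∃ φ : k₁.carrier ≃ₜ k₂.carrier, ∀ γ ∈ k₁.positive, γ.trans φ ∈ k₂.positive := by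
  obtain ⟨γ₁, h₁⟩ := k₁.isClass
  obtain ⟨γ₂, h₂⟩ := k₂.isClass
  refine ⟨γ₁.symm.trans γ₂, fun γ hγ => ?_⟩
  rw [h₁] at hγ
  rw [h₂]
  have : (γ.trans (γ₁.symm.trans γ₂)).trans γ₂.symm = γ.trans γ₁.symm := by
    ext z
    simp
  rw [mem_ofPred_eq, this]
  exact hγ

/-- In a connected noncompact space, a nonempty compact set is never open, so it leaves room in
every open set around it. -/
theorem IsCompact.diff_nonempty_of_subset_isOpen {X : Type*} [TopologicalSpace X] [T2Space X]
    [PreconnectedSpace X] [NoncompactSpace X] {K U : Set X} (hK : IsCompact K)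
    (hne : K.Nonempty) (hU : IsOpen U) (hKU : K ⊆ U) : (U \ K).Nonempty := by
  rw [sdiff_nonempty]
  intro hUK
  obtain rfl := hKU.antisymm hUK
  exact hK.ne_univ (IsClopen.eq_univ ⟨hK.isClosed, hU⟩ hne)

/-- A continuous map into a 3-ball `B`, given on a nonempty compact set `K ⊆ interior B`, extends to
a continuous map of `E3` that is the identity off `interior B` and maps `B` onto itself.
Surjectivity onto `B` is arranged by hand, on a round ball in `interior B` that misses `K`. -/
theorem IsThreeBall.exists_continuous_extension {B K : Set E3} (hB : IsThreeBall B)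
    (hK : IsCompact K) (hne : K.Nonempty) (hKB : K ⊆ interior B) (h : C(K, B)) :
    ∃ f : E3 → E3, Continuous f ∧ (∀ x : K, f x = h x) ∧ (∀ x, x ∉ interior B → f x = x) ∧
      f '' B = B := by
  classical
  have hBc : IsClosed B := hB.isCompact.isClosed
  obtain ⟨b⟩ := hB
  have : TietzeExtension.{0} (Metric.closedBall (0 : E3) 1) :=
    Set.instTietzeExtensionUnitClosedBall (𝕜 := ℝ)
  have : TietzeExtension.{0} B := .of_homeo b
  obtain ⟨c, hc⟩ := hK.diff_nonempty_of_subset_isOpen hne isOpen_interior hKB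
  obtain ⟨r, hr, hrc⟩ := Metric.nhds_basis_closedBall.mem_iff.1
    ((isOpen_interior.sdiff hK.isClosed).mem_nhds hc)
  obtain ⟨p, hp⟩ := exists_surjective_continuousMap_closedBall c hr
  have hKD : Disjoint K (Metric.closedBall c r) :=
    disjoint_left.2 fun x hx hxD => (hrc hxD).2 hx
  obtain ⟨F, hFK, hFD⟩ := exists_continuousMap_extending_pair hK.isClosed
    Metric.isClosed_closedBall hKD h ((b.symm : C(_, B)).comp p)
  -- `G` is `h` on `K`, maps the round ball onto `B`, and fixes the frontier of `B` pointwise.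
  have hfr : Disjoint (K ∪ Metric.closedBall c r) (frontier B) :=
    disjoint_interior_frontier.mono_left (union_subset hKB fun x hx => (hrc hx).1)
  obtain ⟨G, hGF, hGfr⟩ := exists_continuousMap_extending_pair
    (hK.isClosed.union Metric.isClosed_closedBall) isClosed_frontier hfr (F.restrict _)
    ⟨inclusion hBc.frontier_subset, continuous_inclusion _⟩
  let f : E3 → E3 := fun x => if x ∈ B then (G x : E3) else x
  have hmem : ∀ x ∈ B, f x = G x := fun x hx => if_pos hx
  refine ⟨f, ?_, fun x => ?_, fun x hx => ?_, ?_⟩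
  · refine Continuous.if (fun x hx => ?_) (by fun_prop) continuous_id
    exact congrArg Subtype.val (hGfr ⟨x, hx⟩)
  · rw [hmem _ (interior_subset (hKB x.2))]
    exact congrArg Subtype.val ((hGF ⟨x, .inl x.2⟩).trans (hFK x))
  · by_cases hxB : x ∈ B
    · rw [hmem x hxB]
      exact congrArg Subtype.val (hGfr ⟨x, subset_closure hxB, hx⟩)
    · exact if_neg hxB
  · refine Subset.antisymm ?_ fun y hy => ?_
    · rintro _ ⟨x, hx, rfl⟩
      rw [hmem x hx]
      exact (G x).2
    · obtain ⟨d, hd⟩ := hp (b ⟨y, hy⟩)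
      have hdB : (d : E3) ∈ B := interior_subset (hrc d.2).1
      refine ⟨d, hdB, ?_⟩
      rw [hmem _ hdB, (hGF ⟨d, .inr d.2⟩).trans (hFD d)]
      simp [hd]

theorem mainTheorem7 (k₁ k₂ : OrientedKnot) (V₁ V₂ B : Set E3)
    (hV₁ : IsTubularNeighbourhood k₁.carrier V₁) (hV₂ : IsTubularNeighbourhood k₂.carrier V₂)
    (hB : IsThreeBall B) (hVB : V₁ ∪ V₂ ⊆ interior B) :
    ∃ f : E3 → E3, Continuous f ∧
      MapsPairHomeomorphically f V₁ k₁ V₂ k₂ ∧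
      (∀ x : E3, x ∉ interior B → f x = x) ∧
      f '' B = B := by
  obtain ⟨hV₁B, hV₂B⟩ := union_subset_iff.1 hVB
  have := k₁.compactSpace
  obtain ⟨φ, hφ⟩ := k₁.exists_homeomorph k₂
  obtain ⟨e, he⟩ := exists_homeomorph_tubularNeighbourhood φ hV₁ hV₂
  have hV₂B' : V₂ ⊆ B := hV₂B.trans interior_subset
  obtain ⟨f, hf, hfe, hfix, hfB⟩ := hB.exists_continuous_extension hV₁.isCompact
    (k₁.nonempty.mono hV₁.subset) hV₁B
    ⟨inclusion hV₂B' ∘ e, (continuous_inclusion _).comp e.continuous⟩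
  have hfφ : ∀ x : k₁.carrier, f x = φ x := fun x => (hfe ⟨x, hV₁.subset x.2⟩).trans (he x)
  refine ⟨f, hf, ⟨⟨e, fun x => (hfe x).symm⟩, ?_, fun γ hγ => ⟨_, hφ γ hγ, fun z => hfφ _⟩⟩,
    hfix, hfB⟩
  refine Subset.antisymm ?_ fun y hy => ?_
  · rintro _ ⟨x, hx, rfl⟩
    rw [hfφ ⟨x, hx⟩]
    exact (φ ⟨x, hx⟩).2
  · refine ⟨φ.symm ⟨y, hy⟩, (φ.symm ⟨y, hy⟩).2, ?_⟩
    rw [hfφ, φ.apply_symm_apply]
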